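/- Let $n\ge 2$, let $U\subset\mathbb R^n$ be a non-empty connected open set, and let $r>s\ge 1$, $r\ge 3$. Let $\bar x:U\to\mathbb R^{n+1}$ be an injective $C^r$-immersion with unit normal vector field $\bar\xi$ (continuous on $U$) and nowhere vanishing Gaussian curvature $K=\det(h_{ij})/\det(g_{ij})$, where $g_{ij}=\langle\bar x_{/i},\bar x_{/j}\rangle$, $h_{ij}=\langle\bar\xi,\bar x_{/ij}\rangle$, and $_{/i}$ denotes $\partial/\partial u^i$. Let $\bar y:U\to\mathbb R^{n+1}$ be a relative $C^s$-normalization, i.e. a $C^s$-map such that at every point $\bar y\notin T:=\operatorname{span}(\bar x_{/1},\dots,\bar x_{/n})$ and $\bar y_{/i}\in T$ for all $i$. Let $q=\langle\bar\xi,\bar y\rangle$ be its support function (which never vanishes), let $\bar X=q^{-1}\bar\xi$ be the unique vector field with $\langle\bar X,\bar x_{/i}\rangle=0$ for all $i$ and $\langle\bar X,\bar y\rangle=1$, and let $G_{ij}=\langle\bar X,\bar x_{/ij}\rangle$ be the relative metric. Write $\triangle^G f=G^{ij}\bigl(f_{/ij}-{}^G\Gamma^k_{ij}f_{/k}\bigr)$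 for the second Beltrami operator of the (possibly indefinite) metric $G$, applied componentwise to vector-valued functions. The relation $\langle\triangle^G\bar\xi,d\bar x\rangle=0$ means that $\langle\triangle^G\bar\xi,\bar x_{/i}\rangle=0$ for $i=1,\dots,n$. (a) If $n=2$, then $\langle\triangle^G\bar\xi,d\bar x\rangle=0$ at every point of $U$ if and only if $K$ is constant. (b) If $n\ge 3$, then $\langle\triangle^G\bar\xi,d\bar x\rangle=0$ at every point of $U$ if and only if there is a constant $\lambda\in\mathbb R\setminus\{0\}$ with $q=\lambda\,|K|^{1/(n-2)}$ on $U$. -/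

import Mathlib

open scoped InnerProductSpace

namespace RelGeom

noncomputable section

/-- Partial derivative `f_{/i} = ∂f/∂uⁱ` of a (scalar or vector valued) function on `ℝⁿ`. -/
def pd {n : ℕ} {F : Type*} [NormedAddCommGroup F] [NormedSpace ℝ F] (i : Fin n)
    (f : EuclideanSpace ℝ (Fin n) → F) (u : EuclideanSpace ℝ (Fin n)) : F :=
  fderiv ℝ f u (EuclideanSpace.single i 1)

/-- The tangent vector space at the point with parameter `u`, spanned by the `x_{/i}(u)`. -/
def tangentSpace {n : ℕ} (x : EuclideanSpace ℝ (Fin n) → EuclideanSpace ℝ (Fin (n + 1)))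
    (u : EuclideanSpace ℝ (Fin n)) : Submodule ℝ (EuclideanSpace ℝ (Fin (n + 1))) :=
  Submodule.span ℝ (Set.range fun i : Fin n => pd i x u)

/-- `x : U → ℝⁿ⁺¹` is an injective `C^r`-immersion of a domain `U ⊂ ℝⁿ`. -/
structure IsHypersurface {n : ℕ} (r : WithTop ℕ∞) (U : Set (EuclideanSpace ℝ (Fin n)))
    (x : EuclideanSpace ℝ (Fin n) → EuclideanSpace ℝ (Fin (n + 1))) : Prop where
  isOpen : IsOpen U
  isConnected : IsConnected U
  contDiffOn : ContDiffOn ℝ r x U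
  injOn : Set.InjOn x U
  immersion : ∀ u ∈ U, LinearIndependent ℝ (fun i : Fin n => pd i x u)

/-- `ξ` is a Euclidean normalization of `x`: a (continuous) unit normal vector field.
On a domain there are two of them, `ξ` and `-ξ`. -/
structure IsEuclideanNormalization {n : ℕ} (U : Set (EuclideanSpace ℝ (Fin n)))
    (x ξ : EuclideanSpace ℝ (Fin n) → EuclideanSpace ℝ (Fin (n + 1))) : Prop where
  continuousOn : ContinuousOn ξ U
  norm_eq_one : ∀ u ∈ U, ‖ξ u‖ = 1
  normal : ∀ u ∈ U, ∀ i : Fin n, ⟪ξ u, pd i x u⟫_ℝ = 0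

/-- `y` is a relative `C^s`-normalization of `x`. -/
structure IsRelativeNormalization {n : ℕ} (s : WithTop ℕ∞) (U : Set (EuclideanSpace ℝ (Fin n)))
    (x y : EuclideanSpace ℝ (Fin n) → EuclideanSpace ℝ (Fin (n + 1))) : Prop where
  contDiffOn : ContDiffOn ℝ s y U
  transversal : ∀ u ∈ U, y u ∉ tangentSpace x u
  tangential : ∀ u ∈ U, ∀ i : Fin n, pd i y u ∈ tangentSpace x u

/-- First fundamental form `g_{ij} = ⟨x_{/i}, x_{/j}⟩`. -/
def firstForm {n : ℕ} (x : EuclideanSpace ℝ (Fin n) → EuclideanSpace ℝ (Fin (n + 1)))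
    (u : EuclideanSpace ℝ (Fin n)) : Matrix (Fin n) (Fin n) ℝ :=
  Matrix.of fun i j => ⟪pd i x u, pd j x u⟫_ℝ

/-- Second fundamental form `h_{ij} = ⟨ξ, x_{/ij}⟩`. -/
def secondForm {n : ℕ} (x ξ : EuclideanSpace ℝ (Fin n) → EuclideanSpace ℝ (Fin (n + 1)))
    (u : EuclideanSpace ℝ (Fin n)) : Matrix (Fin n) (Fin n) ℝ :=
  Matrix.of fun i j => ⟪ξ u, pd j (pd i x) u⟫_ℝ

/-- Gaussian (Gauss–Kronecker) curvature `K = det (h_{ij}) / det (g_{ij})`. -/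
def gaussCurvature {n : ℕ} (x ξ : EuclideanSpace ℝ (Fin n) → EuclideanSpace ℝ (Fin (n + 1)))
    (u : EuclideanSpace ℝ (Fin n)) : ℝ :=
  (secondForm x ξ u).det / (firstForm x u).det

/-- Support function `q = ⟨ξ, y⟩` of `y`. -/
def support {n : ℕ} (ξ y : EuclideanSpace ℝ (Fin n) → EuclideanSpace ℝ (Fin (n + 1)))
    (u : EuclideanSpace ℝ (Fin n)) : ℝ :=
  ⟪ξ u, y u⟫_ℝ

/-- The covector `X = q⁻¹ ξ` of the tangent hyperplane. By `covector_iff` below it is the unique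
solution of `⟨X, x_{/i}⟩ = 0` for all `i` and `⟨X, y⟩ = 1`. -/
def covector {n : ℕ} (ξ y : EuclideanSpace ℝ (Fin n) → EuclideanSpace ℝ (Fin (n + 1)))
    (u : EuclideanSpace ℝ (Fin n)) : EuclideanSpace ℝ (Fin (n + 1)) :=
  (support ξ y u)⁻¹ • ξ u

/-- Relative metric `G_{ij} = ⟨X, x_{/ij}⟩`. -/
def relMetric {n : ℕ} (x ξ y : EuclideanSpace ℝ (Fin n) → EuclideanSpace ℝ (Fin (n + 1)))
    (u : EuclideanSpace ℝ (Fin n)) : Matrix (Fin n) (Fin n) ℝ :=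
  Matrix.of fun i j => ⟪covector ξ y u, pd j (pd i x) u⟫_ℝ

/-- Christoffel symbols `Γᵏ_{ij} = ½ Gᵏᵐ (G_{mi/j} + G_{mj/i} - G_{ij/m})` of the Levi-Civita
connection of a (possibly indefinite) metric `G`. -/
def christoffel {n : ℕ} (G : EuclideanSpace ℝ (Fin n) → Matrix (Fin n) (Fin n) ℝ)
    (k i j : Fin n) (u : EuclideanSpace ℝ (Fin n)) : ℝ :=
  (1 / 2) * ∑ m : Fin n, (G u)⁻¹ k m *
    (pd j (fun v => G v m i) u + pd i (fun v => G v m j) u - pd m (fun v => G v i j) u)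

/-- Second Beltrami differential operator `Δᴳ f = Gⁱʲ ∇ⱼ f_{/i} = Gⁱʲ (f_{/ij} - Γᵏ_{ij} f_{/k})`
of a metric `G`, for (scalar or) vector valued functions `f`. -/
def beltrami {n : ℕ} {F : Type*} [NormedAddCommGroup F] [NormedSpace ℝ F]
    (G : EuclideanSpace ℝ (Fin n) → Matrix (Fin n) (Fin n) ℝ)
    (f : EuclideanSpace ℝ (Fin n) → F) (u : EuclideanSpace ℝ (Fin n)) : F :=
  ∑ i : Fin n, ∑ j : Fin n, (G u)⁻¹ i j •
    (pd j (pd i f) u - ∑ k : Fin n, christoffel G k i j u • pd k f u)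

section CovectorFacts

variable {n : ℕ} {r s : WithTop ℕ∞} {U : Set (EuclideanSpace ℝ (Fin n))}
  {x ξ y : EuclideanSpace ℝ (Fin n) → EuclideanSpace ℝ (Fin (n + 1))}

theorem mem_orthogonal_tangentSpace_iff {u : EuclideanSpace ℝ (Fin n)}
    {w : EuclideanSpace ℝ (Fin (n + 1))} :
    w ∈ (tangentSpace x u)ᗮ ↔ ∀ i, ⟪w, pd i x u⟫_ℝ = 0 := by
  rw [Submodule.mem_orthogonal']
  constructor
  · intro h i
    exact h _ (Submodule.subset_span ⟨i, rfl⟩)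
  · intro h v hv
    induction hv using Submodule.span_induction with
    | mem v hv => obtain ⟨i, rfl⟩ := hv; exact h i
    | zero => simp
    | add a b _ _ ha hb => rw [inner_add_right, ha, hb, add_zero]
    | smul c a _ ha => rw [inner_smul_right, ha, mul_zero]

theorem orthogonal_tangentSpace (hx : IsHypersurface r U x)
    (hξ : IsEuclideanNormalization U x ξ) {u : EuclideanSpace ℝ (Fin n)} (hu : u ∈ U) :
    (tangentSpace x u)ᗮ = Submodule.span ℝ {ξ u} := by
  have h0 : ξ u ≠ 0 := by
    intro h
    have := hξ.norm_eq_one u hu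
    simp [h] at this
  have h1 : Module.finrank ℝ (tangentSpace x u) = n := by
    have := finrank_span_eq_card (hx.immersion u hu)
    rw [Fintype.card_fin] at this
    exact this
  have h2 := Submodule.finrank_add_finrank_orthogonal (tangentSpace x u)
  rw [h1, finrank_euclideanSpace_fin] at h2
  symm
  apply Submodule.eq_of_le_of_finrank_eq
  · rw [Submodule.span_singleton_le_iff_mem]
    exact mem_orthogonal_tangentSpace_iff.2 (hξ.normal u hu)
  · rw [finrank_span_singleton h0]; omega

/-- The support function of a relative normalization never vanishes. -/
theorem support_ne_zero (hx : IsHypersurface r U x) (hξ : IsEuclideanNormalization U x ξ)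
    (hy : IsRelativeNormalization s U x y) {u : EuclideanSpace ℝ (Fin n)} (hu : u ∈ U) :
    support ξ y u ≠ 0 := by
  intro h
  apply hy.transversal u hu
  rw [← Submodule.orthogonal_orthogonal (tangentSpace x u), orthogonal_tangentSpace hx hξ hu,
    Submodule.mem_orthogonal_singleton_iff_inner_right]
  exact h

/-- `covector ξ y u` is the unique vector `X` with `⟨X, x_{/i}⟩ = 0` and `⟨X, y⟩ = 1`. -/
theorem covector_iff (hx : IsHypersurface r U x) (hξ : IsEuclideanNormalization U x ξ)
    (hy : IsRelativeNormalization s U x y) {u : EuclideanSpace ℝ (Fin n)} (hu : u ∈ U)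
    (X : EuclideanSpace ℝ (Fin (n + 1))) :
    X = covector ξ y u ↔ (∀ i, ⟪X, pd i x u⟫_ℝ = 0) ∧ ⟪X, y u⟫_ℝ = 1 := by
  have hq := support_ne_zero hx hξ hy hu
  constructor
  · rintro rfl
    refine ⟨fun i => ?_, ?_⟩
    · rw [covector, real_inner_smul_left, hξ.normal u hu i, mul_zero]
    · rw [covector, real_inner_smul_left]
      exact inv_mul_cancel₀ hq
  · rintro ⟨h1, h2⟩
    have h3 := mem_orthogonal_tangentSpace_iff.2 h1
    rw [orthogonal_tangentSpace hx hξ hu, Submodule.mem_span_singleton] at h3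
    obtain ⟨c, rfl⟩ := h3
    rw [real_inner_smul_left] at h2
    rw [covector, eq_inv_of_mul_eq_one_left h2]
    rfl

end CovectorFacts

end

end RelGeom

open scoped InnerProductSpace

namespace RelGeom

/-! ### Coordinate calculus and derivatives of determinants. -/

section PartialDerivatives

variable {n : ℕ} {F : Type*} [NormedAddCommGroup F] [NormedSpace ℝ F]
  {U : Set (EuclideanSpace ℝ (Fin n))} {u : EuclideanSpace ℝ (Fin n)}

/-! Everything follows from one formula: `⟨Δᴳ ξ, x_{/k}⟩ = (q/2) ((n - 2) q_{/k}/q - K_{/k}/K)`.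
Hence the tangential part vanishes identically iff `qⁿ⁻²/K` has zero derivative, that is, iff it is
constant on the domain. For the formula, differentiate `⟨ξ_{/i}, x_{/k}⟩ = -q G_{ki}` and contract
with `G⁻¹`. The Christoffel terms cancel the mixed derivatives `G_{ki/j}`
(`sum_inv_mul_christoffel`), leaving `-q_{/k}` and `-(q/2) tr(G⁻¹ G_{/k})`. By Weingarten the
remaining term is `(q/2) tr(g⁻¹ g_{/k})` (`sum_inv_relMetric_mul_inner`). By Jacobi's formula
`pd_det` both traces are logarithmic derivatives of determinants, and `K det g = qⁿ det G`
(`gaussCurvature_eq`) trades them for derivatives of `q` and `K`. Since `ξ` is only assumed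
continuous, its `C²` regularity has to be established first. -/

theorem contDiffOn_pd {m : WithTop ℕ∞} {f : EuclideanSpace ℝ (Fin n) → F} (hU : IsOpen U)
    (hf : ContDiffOn ℝ (m + 1) f U) (i : Fin n) : ContDiffOn ℝ m (pd i f) U :=
  (hf.fderiv_of_isOpen hU le_rfl).clm_apply contDiffOn_const

theorem pd_congr {f g : EuclideanSpace ℝ (Fin n) → F} (hU : IsOpen U) (hu : u ∈ U)
    (h : Set.EqOn f g U) (i : Fin n) : pd i f u = pd i g u := by
  have : f =ᶠ[nhds u] g := Filter.eventuallyEq_of_mem (hU.mem_nhds hu) h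
  rw [pd, pd, this.fderiv_eq]

theorem pd_const (c : F) (i : Fin n) : pd i (fun _ => c) u = 0 := by
  simp [pd]

theorem pd_inner {E : Type*} [NormedAddCommGroup E] [InnerProductSpace ℝ E]
    {f g : EuclideanSpace ℝ (Fin n) → E} (hf : DifferentiableAt ℝ f u)
    (hg : DifferentiableAt ℝ g u) (i : Fin n) :
    pd i (fun v => ⟪f v, g v⟫_ℝ) u = ⟪f u, pd i g u⟫_ℝ + ⟪pd i f u, g u⟫_ℝ :=
  fderiv_inner_apply ℝ hf hg _

theorem pd_mul {f g : EuclideanSpace ℝ (Fin n) → ℝ} (hf : DifferentiableAt ℝ f u)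
    (hg : DifferentiableAt ℝ g u) (i : Fin n) :
    pd i (fun v => f v * g v) u = f u * pd i g u + g u * pd i f u := by
  simp [pd, fderiv_fun_mul hf hg]

theorem pd_pow {f : EuclideanSpace ℝ (Fin n) → ℝ} (hf : DifferentiableAt ℝ f u) (m : ℕ)
    (i : Fin n) : pd i (fun v => f v ^ m) u = m * f u ^ (m - 1) * pd i f u := by
  simp [pd, fderiv_fun_pow m hf]

theorem differentiableAt_div {f g : EuclideanSpace ℝ (Fin n) → ℝ} (hf : DifferentiableAt ℝ f u)
    (hg : DifferentiableAt ℝ g u) (h : g u ≠ 0) : DifferentiableAt ℝ (fun v => f v / g v) u := by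
  simp only [div_eq_mul_inv]
  exact hf.fun_mul (hg.fun_inv h)

theorem pd_comm {f : EuclideanSpace ℝ (Fin n) → F} (hf : ContDiffAt ℝ 2 f u) (i j : Fin n) :
    pd i (pd j f) u = pd j (pd i f) u := by
  have hd : DifferentiableAt ℝ (fderiv ℝ f) u :=
    (hf.fderiv_right (m := 1) (by norm_num)).differentiableAt (by norm_num)
  have key : ∀ a b : Fin n, pd a (pd b f) u =
      fderiv ℝ (fderiv ℝ f) u (EuclideanSpace.single a 1) (EuclideanSpace.single b 1) := by
    intro a b
    have : pd b f = fun v => fderiv ℝ f v (EuclideanSpace.single b 1) := rfl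
    rw [pd, this, fderiv_clm_apply hd (by fun_prop)]
    simp
  rw [key, key]
  exact hf.isSymmSndFDerivAt (by simp) _ _

theorem fderiv_eq_zero_of_pd {f : EuclideanSpace ℝ (Fin n) → F} (h : ∀ i, pd i f u = 0) :
    fderiv ℝ f u = 0 := by
  have := (EuclideanSpace.basisFun (Fin n) ℝ).toBasis.ext (f₁ := (fderiv ℝ f u).toLinearMap)
    (f₂ := 0) (fun i => by simpa [pd] using h i)
  ext v
  exact LinearMap.congr_fun this v

/-- On a domain, a differentiable function is constant iff its partial derivatives vanish. -/
theorem exists_const_iff_pd_eq_zero {f : EuclideanSpace ℝ (Fin n) → F} (hU : IsOpen U)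
    (hc : IsPreconnected U) (hf : DifferentiableOn ℝ f U) :
    (∃ a, ∀ u ∈ U, f u = a) ↔ ∀ u ∈ U, ∀ i, pd i f u = 0 := by
  constructor
  · rintro ⟨a, ha⟩ u hu i
    rw [pd_congr hU hu ha, pd_const]
  · intro h
    exact hU.exists_is_const_of_fderiv_eq_zero hc hf fun u hu => fderiv_eq_zero_of_pd (h u hu)

/-- Jacobi's formula for the derivative of a determinant. -/
theorem pd_det {A : EuclideanSpace ℝ (Fin n) → Matrix (Fin n) (Fin n) ℝ}
    (hA : ∀ i j, DifferentiableAt ℝ (fun v => A v i j) u) (hdet : (A u).det ≠ 0) (k : Fin n) :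
    pd k (fun v => (A v).det) u =
      (A u).det * ∑ i, ∑ j, (A u)⁻¹ i j * pd k (fun v => A v j i) u := by
  -- As a multilinear function of the rows, the determinant differentiates into a sum of
  -- determinants with one row replaced.
  let D : ContinuousMultilinearMap ℝ (fun _ : Fin n => Fin n → ℝ) ℝ :=
    { toMultilinearMap := (Matrix.detRowAlternating (n := Fin n) (R := ℝ)).toMultilinearMap
      cont := Continuous.matrix_det continuous_id }
  have hrow : ∀ i, HasFDerivAt (fun v => A v i) (fderiv ℝ (fun v => A v i) u) u := fun i =>
    (differentiableAt_pi.2 (hA i)).hasFDerivAt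
  have h := HasFDerivAt.multilinear_comp (f := D) hrow
  have hent : ∀ i j, fderiv ℝ (fun v => A v i) u (EuclideanSpace.single k 1) j =
      pd k (fun v => A v i j) u := by
    intro i j
    rw [pd, fderiv_pi (hA i)]
    simp
  have h1 : pd k (fun v => (A v).det) u = ∑ i, ((A u).updateRow i
      (fderiv ℝ (fun v => A v i) u (EuclideanSpace.single k 1))).det := by
    have : (fun v => (A v).det) = fun v => D (fun i => A v i) := rfl
    rw [pd, this, h.fderiv]
    simp only [sum_apply, ContinuousLinearMap.comp_apply]
    rfl
  have hinv : ∀ i j, (A u).adjugate i j = (A u).det * (A u)⁻¹ i j := by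
    intro i j
    rw [Matrix.inv_def, Matrix.smul_apply, Ring.inverse_eq_inv', smul_eq_mul,
      mul_inv_cancel_left₀ hdet]
  rw [h1, Finset.sum_comm, Finset.mul_sum]
  refine Finset.sum_congr rfl fun j _ => ?_
  -- A determinant with one row replaced is a Cramer determinant, hence the adjugate applied to the
  -- new row.
  rw [← Matrix.cramer_transpose_apply, Matrix.cramer_eq_adjugate_mulVec,
    ← Matrix.adjugate_transpose, Matrix.mulVec, dotProduct, Finset.mul_sum]
  refine Finset.sum_congr rfl fun i _ => ?_
  rw [Matrix.transpose_apply, hent, hinv, mul_assoc]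

theorem contDiffAt_det {m : WithTop ℕ∞}
    {A : EuclideanSpace ℝ (Fin n) → Matrix (Fin n) (Fin n) ℝ}
    (hA : ∀ i j, ContDiffAt ℝ m (fun v => A v i j) u) :
    ContDiffAt ℝ m (fun v => (A v).det) u := by
  simp only [Matrix.det_apply]
  exact ContDiffAt.sum fun σ _ => (contDiffAt_prod fun i _ => hA _ _).const_smul _

theorem contDiffAt_adjugate {m : WithTop ℕ∞}
    {A : EuclideanSpace ℝ (Fin n) → Matrix (Fin n) (Fin n) ℝ}
    (hA : ∀ i j, ContDiffAt ℝ m (fun v => A v i j) u) (i j : Fin n) :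
    ContDiffAt ℝ m (fun v => (A v).adjugate i j) u := by
  simp only [Matrix.adjugate_apply]
  refine contDiffAt_det fun a b => ?_
  simp only [Matrix.updateRow_apply]
  split_ifs
  · exact contDiffAt_const
  · exact hA a b

end PartialDerivatives

/-- The contraction with `G⁻¹` of the tangential part of the Hessian, expressed without Christoffel
symbols. Here `dG m i j` stands for `G_{ij/m}`. -/
theorem sum_inv_mul_christoffel {n : ℕ} {G I : Matrix (Fin n) (Fin n) ℝ} (hGI : G * I = 1)
    (hI : ∀ i j, I i j = I j i) (dG : Fin n → Fin n → Fin n → ℝ)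
    (q : ℝ) (dq : Fin n → ℝ) (S T : Fin n → Fin n → ℝ) (k : Fin n)
    (hT : ∀ i j, T i j = -(dq j * G k i + q * dG j k i) - S i j) :
    ∑ i, ∑ j, I i j * (T i j + q * ∑ l, (1 / 2 * ∑ m, I l m * (dG j m i + dG i m j - dG m i j)) *
      G k l) = -dq k - q / 2 * (∑ i, ∑ j, I i j * dG k i j) - ∑ i, ∑ j, I i j * S i j := by
  have hδ : ∀ a b, ∑ l, G a l * I l b = if a = b then 1 else 0 := by
    intro a b
    rw [← Matrix.mul_apply, hGI, Matrix.one_apply]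
  -- Lowering the upper index with `G` gives Christoffel symbols of the first kind.
  have h1 : ∀ i j, ∑ l, (1 / 2 * ∑ m, I l m * (dG j m i + dG i m j - dG m i j)) * G k l =
      1 / 2 * (dG j k i + dG i k j - dG k i j) := by
    intro i j
    calc _ = ∑ m, 1 / 2 * ((∑ l, G k l * I l m) * (dG j m i + dG i m j - dG m i j)) := by
          simp only [Finset.mul_sum, Finset.sum_mul]
          rw [Finset.sum_comm]
          refine Finset.sum_congr rfl fun m _ => Finset.sum_congr rfl fun l _ => by ring
      _ = _ := by simp [hδ]
  have h2 : ∑ i, ∑ j, I i j * (dq j * G k i) = dq k := by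
    calc _ = ∑ j, (∑ i, G k i * I i j) * dq j := by
          rw [Finset.sum_comm]
          simp only [Finset.sum_mul]
          refine Finset.sum_congr rfl fun m _ => Finset.sum_congr rfl fun l _ => by ring
      _ = _ := by simp [hδ]
  -- By symmetry of `I`, two of the three Christoffel terms agree; together they cancel the `q * dG
  -- j k i` coming from `T`.
  have h3 : ∑ i, ∑ j, I i j * dG i k j = ∑ i, ∑ j, I i j * dG j k i := by
    rw [Finset.sum_comm]
    refine Finset.sum_congr rfl fun i _ => Finset.sum_congr rfl fun j _ => by rw [hI]
  calc _ = ∑ i, ∑ j, (-(I i j * (dq j * G k i)) + q / 2 * (I i j * dG i k j)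
          - q / 2 * (I i j * dG j k i) - q / 2 * (I i j * dG k i j) - I i j * S i j) := by
        refine Finset.sum_congr rfl fun i _ => Finset.sum_congr rfl fun j _ => ?_
        rw [h1, hT]
        ring
    _ = _ := by
        simp only [Finset.sum_sub_distrib, Finset.sum_add_distrib, Finset.sum_neg_distrib,
          ← Finset.mul_sum, h2, h3]
        ring

/-! ### Regularity of the normal, Weingarten's equations and curvature. -/

section Hypersurface

variable {n : ℕ} {r s : WithTop ℕ∞} {U : Set (EuclideanSpace ℝ (Fin n))}
  {x ξ y : EuclideanSpace ℝ (Fin n) → EuclideanSpace ℝ (Fin (n + 1))}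
  {u : EuclideanSpace ℝ (Fin n)}

theorem det_firstForm_pos (hx : IsHypersurface r U x) (hu : u ∈ U) : 0 < (firstForm x u).det :=
  (Matrix.posDef_gram_of_linearIndependent (𝕜 := ℝ) (hx.immersion u hu)).det_pos

theorem firstForm_comm (i j : Fin n) : firstForm x u i j = firstForm x u j i :=
  real_inner_comm (pd j x u) (pd i x u)

theorem IsHypersurface.contDiffOn_pd (hx : IsHypersurface r U x) (hr : 3 ≤ r) (i : Fin n) :
    ContDiffOn ℝ 2 (pd i x) U :=
  RelGeom.contDiffOn_pd hx.isOpen ((hx.contDiffOn.of_le hr).of_le (by norm_num)) i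

theorem IsHypersurface.contDiffOn_pd_pd (hx : IsHypersurface r U x) (hr : 3 ≤ r) (i j : Fin n) :
    ContDiffOn ℝ 1 (pd i (pd j x)) U :=
  RelGeom.contDiffOn_pd hx.isOpen ((hx.contDiffOn_pd hr j).of_le (by norm_num)) i

theorem IsHypersurface.pd_comm (hx : IsHypersurface r U x) (hr : 3 ≤ r) (hu : u ∈ U)
    (i j : Fin n) : pd i (pd j x) u = pd j (pd i x) u :=
  RelGeom.pd_comm ((hx.contDiffOn.contDiffAt (hx.isOpen.mem_nhds hu)).of_le
    (le_trans (by norm_num) hr)) i j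

/-- The normal line is the orthogonal complement of the tangent space, so vector identities can be
tested against the `x_{/i}` and `ξ`. -/
theorem eq_zero_of_inner_eq_zero (hx : IsHypersurface r U x) (hξ : IsEuclideanNormalization U x ξ)
    (hu : u ∈ U) {z : EuclideanSpace ℝ (Fin (n + 1))} (h1 : ∀ i, ⟪z, pd i x u⟫_ℝ = 0)
    (h2 : ⟪z, ξ u⟫_ℝ = 0) : z = 0 := by
  have h3 := mem_orthogonal_tangentSpace_iff.2 h1
  rw [orthogonal_tangentSpace hx hξ hu, Submodule.mem_span_singleton] at h3
  obtain ⟨c, rfl⟩ := h3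
  rw [real_inner_smul_left, real_inner_self_eq_norm_sq, hξ.norm_eq_one u hu] at h2
  have : c = 0 := by simpa using h2
  rw [this, zero_smul]

/-- `det g` times the orthogonal projection of `w` to the normal line of the hypersurface. -/
noncomputable def normalPart (x : EuclideanSpace ℝ (Fin n) → EuclideanSpace ℝ (Fin (n + 1)))
    (w : EuclideanSpace ℝ (Fin (n + 1))) (u : EuclideanSpace ℝ (Fin n)) :
    EuclideanSpace ℝ (Fin (n + 1)) :=
  (firstForm x u).det • w -
    ∑ i, ∑ j, ((firstForm x u).adjugate i j * ⟪w, pd i x u⟫_ℝ) • pd j x u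

/-- Since `adj(g) g = det g`, the subtracted sum removes exactly the tangential part. The left side
involves only `x` and a fixed `w`, so it is as smooth as the `x_{/i}`. -/
theorem normalPart_eq (hx : IsHypersurface r U x) (hξ : IsEuclideanNormalization U x ξ)
    (hu : u ∈ U) (w : EuclideanSpace ℝ (Fin (n + 1))) :
    normalPart x w u = ((firstForm x u).det * ⟪w, ξ u⟫_ℝ) • ξ u := by
  rw [← sub_eq_zero]
  have hn : ∀ j, ⟪pd j x u, ξ u⟫_ℝ = 0 := fun j => by rw [real_inner_comm, hξ.normal u hu]
  refine eq_zero_of_inner_eq_zero hx hξ hu (fun k => ?_) ?_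
  · have hadj : ∀ i, ∑ j, (firstForm x u).adjugate i j * ⟪pd j x u, pd k x u⟫_ℝ =
        if i = k then (firstForm x u).det else 0 := by
      intro i
      have := congrFun (congrFun (Matrix.adjugate_mul (firstForm x u)) i) k
      simpa [Matrix.mul_apply, Matrix.one_apply, firstForm] using this
    have h1 : ∑ i, ∑ j, (firstForm x u).adjugate i j * ⟪w, pd i x u⟫_ℝ * ⟪pd j x u, pd k x u⟫_ℝ =
        (firstForm x u).det * ⟪w, pd k x u⟫_ℝ := by
      calc _ = ∑ i, (∑ j, (firstForm x u).adjugate i j * ⟪pd j x u, pd k x u⟫_ℝ) *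
            ⟪w, pd i x u⟫_ℝ := by
            simp only [Finset.sum_mul]
            exact Finset.sum_congr rfl fun i _ => Finset.sum_congr rfl fun j _ => by ring
        _ = _ := by simp [hadj]
    simp only [normalPart, inner_sub_left, real_inner_smul_left, sum_inner, hξ.normal u hu, h1]
    ring
  · simp only [normalPart, inner_sub_left, real_inner_smul_left, sum_inner, hn,
      real_inner_self_eq_norm_sq, hξ.norm_eq_one u hu]
    simp

theorem contDiffAt_firstForm (hx : IsHypersurface r U x) (hr : 3 ≤ r) (hu : u ∈ U) (i j : Fin n) :
    ContDiffAt ℝ 2 (fun v => firstForm x v i j) u :=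
  (((hx.contDiffOn_pd hr i).inner ℝ (hx.contDiffOn_pd hr j)).contDiffAt (hx.isOpen.mem_nhds hu))

theorem contDiffAt_normalPart (hx : IsHypersurface r U x) (hr : 3 ≤ r) (hu : u ∈ U)
    (w : EuclideanSpace ℝ (Fin (n + 1))) : ContDiffAt ℝ 2 (normalPart x w) u := by
  have hp : ∀ i, ContDiffAt ℝ 2 (pd i x) u := fun i =>
    (hx.contDiffOn_pd hr i).contDiffAt (hx.isOpen.mem_nhds hu)
  have hg := contDiffAt_firstForm hx hr hu
  exact ((contDiffAt_det hg).smul contDiffAt_const).sub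
    (ContDiffAt.sum fun i _ => ContDiffAt.sum fun j _ =>
      ((contDiffAt_adjugate hg i j).mul (contDiffAt_const.inner ℝ (hp i))).smul (hp j))

/-- A continuous unit normal field of a `C³`-immersion is of class `C²`. -/
theorem IsEuclideanNormalization.contDiffOn (hξ : IsEuclideanNormalization U x ξ)
    (hx : IsHypersurface r U x) (hr : 3 ≤ r) : ContDiffOn ℝ 2 ξ U := by
  intro u₀ hu₀
  have hU := hx.isOpen.mem_nhds hu₀
  -- Continuity of `ξ` fixes the sign: near `u₀` the normalized normal part of the frozen vector `ξ
  -- u₀` is `ξ u`, not `-ξ u`.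
  have hpos : ∀ᶠ u in nhds u₀, 0 < ⟪ξ u₀, ξ u⟫_ℝ := by
    have hc : ContinuousAt (fun u => ⟪ξ u₀, ξ u⟫_ℝ) u₀ :=
      continuousAt_const.inner (hξ.continuousOn.continuousAt hU)
    refine hc.eventually_const_lt ?_
    simp [hξ.norm_eq_one u₀ hu₀]
  have heq : ∀ᶠ u in nhds u₀, ξ u = ‖normalPart x (ξ u₀) u‖⁻¹ • normalPart x (ξ u₀) u := by
    filter_upwards [hpos, hU] with u h hu
    have h2 := mul_pos (det_firstForm_pos hx hu) h
    rw [normalPart_eq hx hξ hu, norm_smul, hξ.norm_eq_one u hu, mul_one, Real.norm_eq_abs,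
      abs_of_pos h2, smul_smul, inv_mul_cancel₀ h2.ne', one_smul]
  have hne : normalPart x (ξ u₀) u₀ ≠ 0 := by
    intro h0
    have := heq.self_of_nhds
    rw [h0, smul_zero] at this
    have h1 := hξ.norm_eq_one u₀ hu₀
    simp [this] at h1
  have hs := contDiffAt_normalPart hx hr hu₀ (ξ u₀)
  exact (((hs.norm ℝ hne).inv (norm_ne_zero_iff.2 hne)).smul hs).congr_of_eventuallyEq heq
    |>.contDiffWithinAt

theorem IsEuclideanNormalization.differentiableAt (hξ : IsEuclideanNormalization U x ξ)
    (hx : IsHypersurface r U x) (hr : 3 ≤ r) (hu : u ∈ U) : DifferentiableAt ℝ ξ u :=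
  ((hξ.contDiffOn hx hr).contDiffAt (hx.isOpen.mem_nhds hu)).differentiableAt (by norm_num)

theorem IsHypersurface.differentiableAt_pd (hx : IsHypersurface r U x) (hr : 3 ≤ r) (hu : u ∈ U)
    (i : Fin n) : DifferentiableAt ℝ (pd i x) u :=
  ((hx.contDiffOn_pd hr i).contDiffAt (hx.isOpen.mem_nhds hu)).differentiableAt (by norm_num)

theorem IsHypersurface.differentiableAt_pd_pd (hx : IsHypersurface r U x) (hr : 3 ≤ r)
    (hu : u ∈ U) (i j : Fin n) : DifferentiableAt ℝ (pd i (pd j x)) u :=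
  ((hx.contDiffOn_pd_pd hr i j).contDiffAt (hx.isOpen.mem_nhds hu)).differentiableAt (by norm_num)

theorem IsEuclideanNormalization.differentiableAt_pd (hξ : IsEuclideanNormalization U x ξ)
    (hx : IsHypersurface r U x) (hr : 3 ≤ r) (hu : u ∈ U) (i : Fin n) :
    DifferentiableAt ℝ (pd i ξ) u :=
  ((contDiffOn_pd (m := 1) hx.isOpen ((hξ.contDiffOn hx hr).of_le (by norm_num)) i).contDiffAt
    (hx.isOpen.mem_nhds hu)).differentiableAt (by norm_num)

theorem differentiableAt_secondForm (hx : IsHypersurface r U x)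
    (hξ : IsEuclideanNormalization U x ξ) (hr : 3 ≤ r) (hu : u ∈ U) (i j : Fin n) :
    DifferentiableAt ℝ (fun v => secondForm x ξ v i j) u :=
  (hξ.differentiableAt hx hr hu).inner ℝ (hx.differentiableAt_pd_pd hr hu j i)

theorem secondForm_comm (hx : IsHypersurface r U x) (hr : 3 ≤ r) (hu : u ∈ U) (i j : Fin n) :
    secondForm x ξ u i j = secondForm x ξ u j i := by
  simp only [secondForm, Matrix.of_apply, hx.pd_comm hr hu]

theorem differentiableAt_support (hx : IsHypersurface r U x)
    (hξ : IsEuclideanNormalization U x ξ) (hy : IsRelativeNormalization s U x y) (hr : 3 ≤ r)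
    (hs : 1 ≤ s) (hu : u ∈ U) : DifferentiableAt ℝ (support ξ y) u :=
  (hξ.differentiableAt hx hr hu).inner ℝ
    ((hy.contDiffOn.contDiffAt (hx.isOpen.mem_nhds hu)).differentiableAt (by
      intro h; simp [h] at hs))

theorem relMetric_apply (i j : Fin n) :
    relMetric x ξ y u i j = (support ξ y u)⁻¹ * secondForm x ξ u i j := by
  simp [relMetric, covector, secondForm, real_inner_smul_left]

theorem relMetric_eq_smul : relMetric x ξ y u = (support ξ y u)⁻¹ • secondForm x ξ u := by
  ext i j
  rw [relMetric_apply, Matrix.smul_apply, smul_eq_mul]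

theorem differentiableAt_relMetric (hx : IsHypersurface r U x)
    (hξ : IsEuclideanNormalization U x ξ) (hy : IsRelativeNormalization s U x y) (hr : 3 ≤ r)
    (hs : 1 ≤ s) (hu : u ∈ U) (i j : Fin n) :
    DifferentiableAt ℝ (fun v => relMetric x ξ y v i j) u := by
  simp only [relMetric_apply]
  exact ((differentiableAt_support hx hξ hy hr hs hu).inv (support_ne_zero hx hξ hy hu)).mul
    (differentiableAt_secondForm hx hξ hr hu i j)

theorem inner_pd_normal (hx : IsHypersurface r U x) (hξ : IsEuclideanNormalization U x ξ)
    (hr : 3 ≤ r) (hu : u ∈ U) (i k : Fin n) :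
    ⟪pd i ξ u, pd k x u⟫_ℝ = -secondForm x ξ u k i := by
  have h := pd_inner (hξ.differentiableAt hx hr hu) (hx.differentiableAt_pd hr hu k) i
  rw [pd_congr hx.isOpen hu (g := fun _ => 0) (fun v hv => hξ.normal v hv k), pd_const] at h
  simp only [secondForm, Matrix.of_apply]
  linarith

theorem inner_pd_normal_self (hx : IsHypersurface r U x) (hξ : IsEuclideanNormalization U x ξ)
    (hr : 3 ≤ r) (hu : u ∈ U) (i : Fin n) : ⟪pd i ξ u, ξ u⟫_ℝ = 0 := by
  have hd := hξ.differentiableAt hx hr hu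
  have h := pd_inner hd hd i
  rw [pd_congr hx.isOpen hu (g := fun _ => 1) (fun v hv => by
    simp [hξ.norm_eq_one v hv]), pd_const, real_inner_comm] at h
  linarith

theorem inner_pd_pd_normal (hx : IsHypersurface r U x) (hξ : IsEuclideanNormalization U x ξ)
    (hr : 3 ≤ r) (hu : u ∈ U) (i j k : Fin n) :
    ⟪pd j (pd i ξ) u, pd k x u⟫_ℝ =
      -pd j (fun v => secondForm x ξ v k i) u - ⟪pd i ξ u, pd j (pd k x) u⟫_ℝ := by
  have h := pd_inner (hξ.differentiableAt_pd hx hr hu i) (hx.differentiableAt_pd hr hu k) j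
  rw [pd_congr hx.isOpen hu (g := fun v => -secondForm x ξ v k i)
    (fun v hv => inner_pd_normal hx hξ hr hv i k)] at h
  have h2 : pd j (fun v => -secondForm x ξ v k i) u = -pd j (fun v => secondForm x ξ v k i) u := by
    simp [pd]
  rw [h2] at h
  linarith

/-- Weingarten's equations. -/
theorem pd_normal_eq (hx : IsHypersurface r U x) (hξ : IsEuclideanNormalization U x ξ)
    (hr : 3 ≤ r) (hu : u ∈ U) (i : Fin n) :
    pd i ξ u = -∑ l, ∑ m, (secondForm x ξ u l i * (firstForm x u)⁻¹ l m) • pd m x u := by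
  rw [← sub_eq_zero, sub_neg_eq_add]
  have hn : ∀ j, ⟪pd j x u, ξ u⟫_ℝ = 0 := fun j => by rw [real_inner_comm, hξ.normal u hu]
  refine eq_zero_of_inner_eq_zero hx hξ hu (fun k => ?_) ?_
  · have hinv : ∀ l, ∑ m, (firstForm x u)⁻¹ l m * ⟪pd m x u, pd k x u⟫_ℝ =
        if l = k then 1 else 0 := by
      intro l
      have := congrFun (congrFun (Matrix.nonsing_inv_mul (firstForm x u)
        (det_firstForm_pos hx hu).ne'.isUnit) l) k
      simpa only [Matrix.mul_apply, Matrix.one_apply, firstForm, Matrix.of_apply] using this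
    simp only [inner_add_left, sum_inner, real_inner_smul_left, mul_assoc, ← Finset.mul_sum, hinv,
      inner_pd_normal hx hξ hr hu]
    simp
  · simp [inner_add_left, sum_inner, real_inner_smul_left, hn, inner_pd_normal_self hx hξ hr hu]

/-- The product rule splits `g_{ji/k}` into two terms with equal contractions, because `g⁻¹` is
symmetric. -/
theorem sum_inv_mul_pd_firstForm (hx : IsHypersurface r U x) (hr : 3 ≤ r) (hu : u ∈ U)
    (k : Fin n) :
    ∑ i, ∑ j, (firstForm x u)⁻¹ i j * pd k (fun v => firstForm x v j i) u =
      2 * ∑ i, ∑ j, (firstForm x u)⁻¹ i j * ⟪pd j x u, pd k (pd i x) u⟫_ℝ := by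
  have hsymm : ∀ i j, (firstForm x u)⁻¹ i j = (firstForm x u)⁻¹ j i := by
    intro i j
    have : (firstForm x u).IsSymm := Matrix.IsSymm.ext fun i j => firstForm_comm j i
    exact (this.inv.apply j i)
  have hd : ∀ i j, pd k (fun v => firstForm x v j i) u =
      ⟪pd j x u, pd k (pd i x) u⟫_ℝ + ⟪pd i x u, pd k (pd j x) u⟫_ℝ := by
    intro i j
    rw [real_inner_comm (pd k (pd j x) u)]
    exact pd_inner (hx.differentiableAt_pd hr hu j) (hx.differentiableAt_pd hr hu i) k
  have hswap : ∑ i, ∑ j, (firstForm x u)⁻¹ i j * ⟪pd i x u, pd k (pd j x) u⟫_ℝ =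
      ∑ i, ∑ j, (firstForm x u)⁻¹ i j * ⟪pd j x u, pd k (pd i x) u⟫_ℝ := by
    rw [Finset.sum_comm]
    exact Finset.sum_congr rfl fun i _ => Finset.sum_congr rfl fun j _ => by rw [hsymm]
  simp only [hd, mul_add, Finset.sum_add_distrib, hswap]
  ring

/-- From `h = q G` one gets `det h = qⁿ det G`; stated without division so that it can be
differentiated directly. -/
theorem gaussCurvature_eq (hx : IsHypersurface r U x) (hξ : IsEuclideanNormalization U x ξ)
    (hy : IsRelativeNormalization s U x y) (hu : u ∈ U) :
    gaussCurvature x ξ u * (firstForm x u).det =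
      support ξ y u ^ n * (relMetric x ξ y u).det := by
  have hq := support_ne_zero hx hξ hy hu
  rw [gaussCurvature, div_mul_cancel₀ _ (det_firstForm_pos hx hu).ne', relMetric_eq_smul,
    Matrix.det_smul, Fintype.card_fin, inv_pow, mul_inv_cancel_left₀ (pow_ne_zero _ hq)]

theorem det_relMetric_ne_zero (hx : IsHypersurface r U x) (hξ : IsEuclideanNormalization U x ξ)
    (hy : IsRelativeNormalization s U x y) (hu : u ∈ U) (hK : gaussCurvature x ξ u ≠ 0) :
    (relMetric x ξ y u).det ≠ 0 := by
  intro h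
  have := gaussCurvature_eq hx hξ hy hu
  rw [h, mul_zero] at this
  exact mul_ne_zero hK (det_firstForm_pos hx hu).ne' this

theorem differentiableAt_gaussCurvature (hx : IsHypersurface r U x)
    (hξ : IsEuclideanNormalization U x ξ) (hr : 3 ≤ r) (hu : u ∈ U) :
    DifferentiableAt ℝ (gaussCurvature x ξ) u := by
  have h1 : ∀ i j, ContDiffAt ℝ 1 (fun v => secondForm x ξ v i j) u := fun i j =>
    ((((hξ.contDiffOn hx hr).of_le (by norm_num)).inner ℝ
      (hx.contDiffOn_pd_pd hr j i)).contDiffAt (hx.isOpen.mem_nhds hu))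
  have hh := (contDiffAt_det h1).differentiableAt (by norm_num)
  have hg := (contDiffAt_det (contDiffAt_firstForm hx hr hu)).differentiableAt (by norm_num)
  exact differentiableAt_div hh hg (det_firstForm_pos hx hu).ne'

end Hypersurface

/-! ### The tangential part of the Beltrami operator applied to the normal. -/

section Beltrami

variable {n : ℕ} {r s : WithTop ℕ∞} {U : Set (EuclideanSpace ℝ (Fin n))}
  {x ξ y : EuclideanSpace ℝ (Fin n) → EuclideanSpace ℝ (Fin (n + 1))}
  {u : EuclideanSpace ℝ (Fin n)}

theorem secondForm_eq_mul (hx : IsHypersurface r U x) (hξ : IsEuclideanNormalization U x ξ)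
    (hy : IsRelativeNormalization s U x y) (hu : u ∈ U) (i j : Fin n) :
    secondForm x ξ u i j = support ξ y u * relMetric x ξ y u i j := by
  rw [relMetric_apply, mul_inv_cancel_left₀ (support_ne_zero hx hξ hy hu)]

theorem relMetric_comm (hx : IsHypersurface r U x) (hr : 3 ≤ r) (hu : u ∈ U) (i j : Fin n) :
    relMetric x ξ y u i j = relMetric x ξ y u j i := by
  rw [relMetric_apply, relMetric_apply, secondForm_comm hx hr hu]

theorem inv_relMetric_comm (hx : IsHypersurface r U x) (hr : 3 ≤ r) (hu : u ∈ U) (i j : Fin n) :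
    (relMetric x ξ y u)⁻¹ i j = (relMetric x ξ y u)⁻¹ j i := by
  have : (relMetric x ξ y u).IsSymm := Matrix.IsSymm.ext fun i j => relMetric_comm hx hr hu j i
  exact this.inv.apply j i

/-- Weingarten gives `ξ_{/i} = -q G_{li} gˡᵐ x_{/m}`. Here `G_{li}` cancels against `G⁻¹`, so only
the Euclidean metric survives. -/
theorem sum_inv_relMetric_mul_inner (hx : IsHypersurface r U x)
    (hξ : IsEuclideanNormalization U x ξ) (hy : IsRelativeNormalization s U x y) (hr : 3 ≤ r)
    (hu : u ∈ U) (hK : gaussCurvature x ξ u ≠ 0) (k : Fin n) :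
    ∑ i, ∑ j, (relMetric x ξ y u)⁻¹ i j * ⟪pd i ξ u, pd j (pd k x) u⟫_ℝ =
      -(support ξ y u / 2) *
        ∑ i, ∑ j, (firstForm x u)⁻¹ i j * pd k (fun v => firstForm x v j i) u := by
  have hδ : ∀ l j, ∑ i, relMetric x ξ y u l i * (relMetric x ξ y u)⁻¹ i j =
      if l = j then 1 else 0 := by
    intro l j
    rw [← Matrix.mul_apply, Matrix.mul_nonsing_inv _
      (det_relMetric_ne_zero hx hξ hy hu hK).isUnit, Matrix.one_apply]
  rw [sum_inv_mul_pd_firstForm hx hr hu]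
  calc _ = -∑ i, ∑ j, ∑ l, ∑ m, support ξ y u * (relMetric x ξ y u l i *
          (relMetric x ξ y u)⁻¹ i j) * ((firstForm x u)⁻¹ l m * ⟪pd m x u, pd k (pd j x) u⟫_ℝ) := by
        simp only [← Finset.sum_neg_distrib]
        refine Finset.sum_congr rfl fun i _ => Finset.sum_congr rfl fun j _ => ?_
        rw [pd_normal_eq hx hξ hr hu, hx.pd_comm hr hu j k]
        simp only [inner_neg_left, sum_inner, real_inner_smul_left, mul_neg,
          secondForm_eq_mul hx hξ hy hu, Finset.mul_sum, Finset.sum_neg_distrib]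
        congr 1
        refine Finset.sum_congr rfl fun l _ => Finset.sum_congr rfl fun m _ => by ring
    _ = -∑ j, ∑ l, ∑ m, support ξ y u * (∑ i, relMetric x ξ y u l i *
          (relMetric x ξ y u)⁻¹ i j) * ((firstForm x u)⁻¹ l m * ⟪pd m x u, pd k (pd j x) u⟫_ℝ) := by
        simp only [Finset.mul_sum, Finset.sum_mul]
        congr 1
        rw [Finset.sum_comm]
        refine Finset.sum_congr rfl fun j _ => ?_
        rw [Finset.sum_comm]
        refine Finset.sum_congr rfl fun l _ => ?_
        rw [Finset.sum_comm]
    _ = -∑ j, ∑ m, support ξ y u * ((firstForm x u)⁻¹ j m * ⟪pd m x u, pd k (pd j x) u⟫_ℝ) := by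
        simp [hδ]
    _ = _ := by
        simp only [← Finset.mul_sum]
        ring

theorem inner_beltrami_normal (hx : IsHypersurface r U x)
    (hξ : IsEuclideanNormalization U x ξ) (hy : IsRelativeNormalization s U x y) (hr : 3 ≤ r)
    (hs : 1 ≤ s) (hu : u ∈ U) (hK : gaussCurvature x ξ u ≠ 0) (k : Fin n) :
    ⟪beltrami (relMetric x ξ y) ξ u, pd k x u⟫_ℝ =
      -pd k (support ξ y) u -
      support ξ y u / 2 *
        (∑ i, ∑ j, (relMetric x ξ y u)⁻¹ i j * pd k (fun v => relMetric x ξ y v i j) u) +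
      support ξ y u / 2 *
        ∑ i, ∑ j, (firstForm x u)⁻¹ i j * pd k (fun v => firstForm x v j i) u := by
  have hT : ∀ i j, ⟪pd j (pd i ξ) u, pd k x u⟫_ℝ =
      -(pd j (support ξ y) u * relMetric x ξ y u k i +
        support ξ y u * pd j (fun v => relMetric x ξ y v k i) u) -
        ⟪pd i ξ u, pd j (pd k x) u⟫_ℝ := by
    intro i j
    rw [inner_pd_pd_normal hx hξ hr hu, pd_congr hx.isOpen hu
      (fun v hv => secondForm_eq_mul hx hξ hy hv k i),
      pd_mul (differentiableAt_support hx hξ hy hr hs hu)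
        (differentiableAt_relMetric hx hξ hy hr hs hu k i)]
    ring
  have h := sum_inv_mul_christoffel
    (Matrix.mul_nonsing_inv _ (det_relMetric_ne_zero hx hξ hy hu hK).isUnit)
    (inv_relMetric_comm hx hr hu) (fun m i j => pd m (fun v => relMetric x ξ y v i j) u)
    (support ξ y u) (fun j => pd j (support ξ y) u) _ _ k hT
  rw [sum_inv_relMetric_mul_inner hx hξ hy hr hu hK] at h
  rw [neg_mul, sub_neg_eq_add] at h
  rw [← h, beltrami]
  simp only [sum_inner, real_inner_smul_left, inner_sub_left, inner_pd_normal hx hξ hr hu,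
    secondForm_eq_mul hx hξ hy hu, christoffel]
  refine Finset.sum_congr rfl fun i _ => Finset.sum_congr rfl fun j _ => ?_
  rw [Finset.mul_sum (s := Finset.univ) (a := support ξ y u), sub_eq_add_neg,
    ← Finset.sum_neg_distrib]
  congr 2
  exact Finset.sum_congr rfl fun l _ => by ring

/-- The tangential part of `Δᴳ ξ`:
`⟨Δᴳ ξ, x_{/k}⟩ = (q / 2) ((n - 2) q_{/k} / q - K_{/k} / K)`, cleared of denominators. -/
theorem inner_beltrami_normal_eq (hx : IsHypersurface r U x)
    (hξ : IsEuclideanNormalization U x ξ) (hy : IsRelativeNormalization s U x y) (hr : 3 ≤ r)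
    (hs : 1 ≤ s) (hu : u ∈ U) (hK : gaussCurvature x ξ u ≠ 0) (k : Fin n) :
    2 * gaussCurvature x ξ u * ⟪beltrami (relMetric x ξ y) ξ u, pd k x u⟫_ℝ =
      ((n : ℝ) - 2) * gaussCurvature x ξ u * pd k (support ξ y) u -
        support ξ y u * pd k (gaussCurvature x ξ) u := by
  rw [inner_beltrami_normal hx hξ hy hr hs hu hK]
  have hq := support_ne_zero hx hξ hy hu
  have hg := (det_firstForm_pos hx hu).ne'
  have hG := det_relMetric_ne_zero hx hξ hy hu hK
  have dq := differentiableAt_support hx hξ hy hr hs hu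
  have dK := differentiableAt_gaussCurvature hx hξ hr hu
  have dg : DifferentiableAt ℝ (fun v => (firstForm x v).det) u :=
    (contDiffAt_det (contDiffAt_firstForm hx hr hu)).differentiableAt (by norm_num)
  have dG : DifferentiableAt ℝ (fun v => (relMetric x ξ y v).det) u := by
    simp only [Matrix.det_apply]
    have := differentiableAt_relMetric hx hξ hy hr hs hu
    fun_prop
  -- Differentiating `K det g = qⁿ det G` with Jacobi's formula supplies the one relation that
  -- eliminates both traces.
  have h := pd_congr hx.isOpen hu (fun v hv => gaussCurvature_eq hx hξ hy hv) k
  rw [pd_mul dK dg, pd_mul (dq.fun_pow n) dG, pd_pow dq,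
    pd_det (fun i j => (contDiffAt_firstForm hx hr hu i j).differentiableAt (by norm_num)) hg,
    pd_det (differentiableAt_relMetric hx hξ hy hr hs hu) hG] at h
  have hsw : ∑ i, ∑ j, (relMetric x ξ y u)⁻¹ i j * pd k (fun v => relMetric x ξ y v i j) u =
      ∑ i, ∑ j, (relMetric x ξ y u)⁻¹ i j * pd k (fun v => relMetric x ξ y v j i) u := by
    rw [Finset.sum_comm]
    exact Finset.sum_congr rfl fun i _ => Finset.sum_congr rfl fun j _ => by
      rw [inv_relMetric_comm hx hr hu]
  rw [hsw]
  have hKg := gaussCurvature_eq hx hξ hy hu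
  have hpow : support ξ y u * (n * support ξ y u ^ (n - 1)) = n * support ξ y u ^ n := by
    rcases Nat.eq_zero_or_pos n with rfl | hn
    · simp
    · rw [mul_left_comm, mul_pow_sub_one hn.ne']
  generalize (∑ i, ∑ j, (relMetric x ξ y u)⁻¹ i j * pd k (fun v => relMetric x ξ y v j i) u) = A
    at h ⊢
  generalize (∑ i, ∑ j, (firstForm x u)⁻¹ i j * pd k (fun v => firstForm x v j i) u) = B at h ⊢
  generalize (relMetric x ξ y u).det = D at *
  generalize (firstForm x u).det = d at *
  generalize gaussCurvature x ξ u = K at *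
  generalize pd k (gaussCurvature x ξ) u = K' at *
  generalize pd k (support ξ y) u = q' at *
  generalize support ξ y u = q at *
  apply mul_right_cancel₀ hg
  linear_combination q * h - (q * A + n * q') * hKg + D * q' * hpow

/-- The tangential part of `Δᴳ ξ` vanishes identically iff `qⁿ⁻² / K` is constant. -/
theorem inner_beltrami_normal_eq_zero_iff (hn : 2 ≤ n) (hx : IsHypersurface r U x)
    (hξ : IsEuclideanNormalization U x ξ) (hy : IsRelativeNormalization s U x y) (hr : 3 ≤ r)
    (hs : 1 ≤ s) (hK : ∀ u ∈ U, gaussCurvature x ξ u ≠ 0) :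
    (∀ u ∈ U, ∀ i : Fin n, ⟪beltrami (relMetric x ξ y) ξ u, pd i x u⟫_ℝ = 0) ↔
      ∃ a, ∀ u ∈ U, support ξ y u ^ (n - 2) / gaussCurvature x ξ u = a := by
  have dq := fun u hu => differentiableAt_support hx hξ hy hr hs (u := u) hu
  have dK := fun u hu => differentiableAt_gaussCurvature hx hξ hr (u := u) hu
  have dF : ∀ u ∈ U, DifferentiableAt ℝ
      (fun u => support ξ y u ^ (n - 2) / gaussCurvature x ξ u) u := fun u hu =>
    differentiableAt_div ((dq u hu).fun_pow _) (dK u hu) (hK u hu)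
  rw [exists_const_iff_pd_eq_zero hx.isOpen hx.isConnected.isPreconnected
    (fun u hu => (dF u hu).differentiableWithinAt)]
  refine forall₂_congr fun u hu => forall_congr' fun i => ?_
  have hq := support_ne_zero hx hξ hy hu
  -- The product rule for `(qⁿ⁻²/K) * K = qⁿ⁻²` replaces the quotient rule.
  have h := pd_mul (dF u hu) (dK u hu) i
  rw [pd_congr hx.isOpen hu (g := fun u => support ξ y u ^ (n - 2))
    (fun v hv => div_mul_cancel₀ _ (hK v hv)), pd_pow (dq u hu)] at h
  -- For `n = 2` the exponent `n - 2 - 1` truncates to `0`, but the factor `n - 2` makes both sides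
  -- vanish.
  have hpow : support ξ y u * (((n - 2 : ℕ) : ℝ) * support ξ y u ^ (n - 2 - 1)) =
      ((n : ℝ) - 2) * support ξ y u ^ (n - 2) := by
    rcases Nat.eq_zero_or_pos (n - 2) with h0 | h0
    · have : n = 2 := by omega
      subst this
      simp
    · rw [mul_left_comm, mul_pow_sub_one h0.ne', Nat.cast_sub hn, Nat.cast_ofNat]
  have key := inner_beltrami_normal_eq hx hξ hy hr hs hu (hK u hu) i
  have hK := hK u hu
  -- The tangential component and the derivative of `qⁿ⁻²/K` differ only by nonvanishing factors.
  have hmain : support ξ y u ^ (n - 2) * (2 * gaussCurvature x ξ u *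
      ⟪beltrami (relMetric x ξ y) ξ u, pd i x u⟫_ℝ) =
      support ξ y u * gaussCurvature x ξ u ^ 2 *
        pd i (fun u => support ξ y u ^ (n - 2) / gaussCurvature x ξ u) u := by
    rw [key]
    have e := div_mul_cancel₀ (support ξ y u ^ (n - 2)) hK
    linear_combination (support ξ y u * gaussCurvature x ξ u) * h -
      gaussCurvature x ξ u * pd i (support ξ y) u * hpow +
      support ξ y u * pd i (gaussCurvature x ξ) u * e
  constructor
  · intro h0
    rw [h0, mul_zero, mul_zero] at hmain
    exact (mul_eq_zero.1 hmain.symm).resolve_left (mul_ne_zero hq (pow_ne_zero _ hK))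
  · intro h0
    rw [h0, mul_zero] at hmain
    exact (mul_eq_zero.1 ((mul_eq_zero.1 hmain).resolve_left (pow_ne_zero _ hq))).resolve_left
      (mul_ne_zero two_ne_zero hK)

end Beltrami

/-! ### Signs and roots on a connected set. -/

/-- A nowhere vanishing continuous real function on a preconnected set is a constant sign times
its absolute value. -/
theorem exists_sign_mul_abs {X : Type*} [TopologicalSpace X] {U : Set X} (hU : IsPreconnected U)
    {f : X → ℝ} (hf : ContinuousOn f U) (h0 : ∀ u ∈ U, f u ≠ 0) :
    ∃ e : ℝ, e ≠ 0 ∧ ∀ u ∈ U, f u = e * |f u| := by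
  have h := hU.eq_or_eq_neg_of_sq_eq hf hf.abs (fun u _ => by simp)
    (fun hu => abs_ne_zero.2 (h0 _ hu))
  rcases h with h | h
  · exact ⟨1, one_ne_zero, fun u hu => by rw [one_mul]; exact h hu⟩
  · exact ⟨-1, by norm_num, fun u hu => by rw [neg_one_mul]; exact h hu⟩

/-- For nowhere vanishing continuous functions on a domain, `qᵐ / K` is constant iff `q` is a
constant multiple of `|K| ^ (1 / m)`. -/
theorem exists_pow_div_eq_iff {X : Type*} [TopologicalSpace X] {U : Set X} (hU : IsConnected U)
    {q K : X → ℝ} (hq : ContinuousOn q U) (hK : ContinuousOn K U) (hq0 : ∀ u ∈ U, q u ≠ 0)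
    (hK0 : ∀ u ∈ U, K u ≠ 0) {m : ℕ} (hm : m ≠ 0) :
    (∃ a, ∀ u ∈ U, q u ^ m / K u = a) ↔
      ∃ c : ℝ, c ≠ 0 ∧ ∀ u ∈ U, q u = c * |K u| ^ (1 / (m : ℝ)) := by
  constructor
  · rintro ⟨a, ha⟩
    obtain ⟨e, he, hqe⟩ := exists_sign_mul_abs hU.isPreconnected hq hq0
    obtain ⟨u₀, hu₀⟩ := hU.nonempty
    have ha0 : a ≠ 0 := by
      rw [← ha u₀ hu₀]
      exact div_ne_zero (pow_ne_zero _ (hq0 _ hu₀)) (hK0 _ hu₀)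
    -- Absolute values give `|q|^m = |a| |K|`; take the `m`-th root and restore the constant sign
    -- `e` of `q`.
    refine ⟨e * |a| ^ (1 / (m : ℝ)),
      mul_ne_zero he (Real.rpow_pos_of_pos (abs_pos.2 ha0) _).ne', fun u hu => ?_⟩
    have h : |q u| ^ m = |a| * |K u| := by
      rw [← abs_pow, ← abs_mul, ← ha u hu, div_mul_cancel₀ _ (hK0 u hu)]
    rw [mul_assoc, ← Real.mul_rpow (abs_nonneg _) (abs_nonneg _), ← h, one_div,
      Real.pow_rpow_inv_natCast (abs_nonneg _) hm]
    exact hqe u hu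
  · rintro ⟨c, -, h⟩
    obtain ⟨e, he, hKe⟩ := exists_sign_mul_abs hU.isPreconnected hK hK0
    -- Here `q^m = c^m |K|` and `K = e |K|`, with `e` the constant sign of `K`.
    refine ⟨c ^ m / e, fun u hu => ?_⟩
    rw [h u hu, mul_pow, one_div, Real.rpow_inv_natCast_pow (abs_nonneg _) hm,
      div_eq_div_iff (hK0 u hu) he, mul_assoc, mul_comm |K u|, ← hKe u hu]

end RelGeom

theorem mainTheorem5 (n : ℕ) (r s : WithTop ℕ∞) (hs : 1 ≤ s) (hrs : s < r) (hr : 3 ≤ r)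
    (U : Set (EuclideanSpace ℝ (Fin n)))
    (x ξ y : EuclideanSpace ℝ (Fin n) → EuclideanSpace ℝ (Fin (n + 1)))
    (hx : RelGeom.IsHypersurface r U x)
    (hξ : RelGeom.IsEuclideanNormalization U x ξ)
    (hK : ∀ u ∈ U, RelGeom.gaussCurvature x ξ u ≠ 0)
    (hy : RelGeom.IsRelativeNormalization s U x y) :
    (n = 2 →
      ((∀ u ∈ U, ∀ i : Fin n,
          inner ℝ (RelGeom.beltrami (RelGeom.relMetric x ξ y) ξ u) (RelGeom.pd i x u) = 0) ↔
        ∃ c : ℝ, ∀ u ∈ U, RelGeom.gaussCurvature x ξ u = c)) ∧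
    (3 ≤ n →
      ((∀ u ∈ U, ∀ i : Fin n,
          inner ℝ (RelGeom.beltrami (RelGeom.relMetric x ξ y) ξ u) (RelGeom.pd i x u) = 0) ↔
        ∃ c : ℝ, c ≠ 0 ∧ ∀ u ∈ U,
          RelGeom.support ξ y u =
            c * |RelGeom.gaussCurvature x ξ u| ^ (1 / ((n : ℝ) - 2)))) := by
  constructor
  · intro hn
    rw [RelGeom.inner_beltrami_normal_eq_zero_iff hn.ge hx hξ hy hr hs hK]
    -- For `n = 2` the quotient `qⁿ⁻²/K` is just `1/K`.
    subst hn
    simp only [Nat.sub_self, pow_zero, one_div]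
    constructor
    · rintro ⟨a, ha⟩
      exact ⟨a⁻¹, fun u hu => by rw [← ha u hu, inv_inv]⟩
    · rintro ⟨c, hc⟩
      exact ⟨c⁻¹, fun u hu => by rw [hc u hu]⟩
  · intro hn
    rw [RelGeom.inner_beltrami_normal_eq_zero_iff (by omega) hx hξ hy hr hs hK,
      RelGeom.exists_pow_div_eq_iff hx.isConnected
        (fun u hu => (RelGeom.differentiableAt_support hx hξ hy hr hs hu).continuousAt
          |>.continuousWithinAt)
        (fun u hu => (RelGeom.differentiableAt_gaussCurvature hx hξ hr hu).continuousAt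
          |>.continuousWithinAt)
        (fun u hu => RelGeom.support_ne_zero hx hξ hy hu) hK (by omega : n - 2 ≠ 0),
      Nat.cast_sub (by omega : 2 ≤ n), Nat.cast_ofNat]
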